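/- For $t=(t_1,t_2,t_3)\in\mathbb{R}^3$ let $$[t]^\wedge=\begin{pmatrix}0&-t_3&t_2\\ t_3&0&-t_1\\ -t_2&t_1&0\end{pmatrix},$$ and let $$\mathscr{L}=\left\{\begin{pmatrix}R&0\\ [t]^\wedge R&R\end{pmatrix} : R\in\mathbb{R}^{3\times3},\ R^{\mathrm T}R=I,\ t\in\mathbb{R}^3\right\}\subset\mathbb{R}^{6\times 6}.$$ Then $\mathscr{L}$ is closed under matrix multiplication, every element of $\mathscr{L}$ is invertible with inverse in $\mathscr{L}$, and $\mathscr{L}$ is topologically closed in $\mathrm{GL}(6,\mathbb{R})$. Moreover, $\mathscr{L}$ is a subgroup of $\mathrm{GL}(6,\mathbb{R})$ (with matrix multiplication as group operation) and an embedded Lie subgroup: equipped with the subspace topology, it admits a smooth manifold structure for which multiplication and inversion are smooth and the inclusion $\mathscr{L}\hookrightarrow\mathrm{GL}(6,\mathbb{R})$ is a smooth embedding. -/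

import Mathlib

open scoped Manifold ContDiff MatrixGroups

/-
The operator norm on matrices makes the matrix algebra a complete normed algebra, so that its unit
group `GL` carries the standard Lie group structure, as an open subset of the matrix space. All
norms on this finite-dimensional space are equivalent, so the choice of the norm is immaterial.
-/
attribute [local instance] Matrix.linftyOpNormedRing
attribute [local instance] Matrix.linftyOpNormedAlgebra

/-- Real `6 × 6` matrices, with rows and columns indexed by two blocks of size three. -/
abbrev Mat6 : Type := Matrix (Fin 3 ⊕ Fin 3) (Fin 3 ⊕ Fin 3) ℝ

/-- The group `GL(6, ℝ)` of invertible real `6 × 6` matrices. -/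
abbrev GL6 : Type := GL (Fin 3 ⊕ Fin 3) ℝ

/-- The standard manifold structure of `GL(6, ℝ)`: the one of an open subset of the matrix space,
whose single chart is the inclusion. It is Mathlib's structure on the units of a complete normed
ring, restated so that the entrywise topology of matrices and the topology of the norm, which are
the same, are matched. -/
noncomputable instance chartedSpaceGL6 :
    @ChartedSpace Mat6 PseudoMetricSpace.toUniformSpace.toTopologicalSpace GL6 _ :=
  Units.instChartedSpace (R := Mat6)

/-- With this structure `GL(6, ℝ)` is a Lie group. -/
theorem lieGroupGL6 : LieGroup 𝓘(ℝ, Mat6) ∞ GL6 :=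
  Units.instLieGroupModelWithCornersSelf (R := Mat6)

/-- The skew-symmetric matrix `[t]^∧` of a vector `t ∈ ℝ³`. -/
def hat (t : Fin 3 → ℝ) : Matrix (Fin 3) (Fin 3) ℝ :=
  !![0, -t 2, t 1;
     t 2, 0, -t 0;
     -t 1, t 0, 0]

/-- The set of the `6 × 6` block matrices `[[R, 0], [[t]^∧ R, R]]` with `R` a real orthogonal
`3 × 3` matrix and `t ∈ ℝ³`. -/
def inducedAdjointSet : Set Mat6 :=
  {M | ∃ R ∈ Matrix.orthogonalGroup (Fin 3) ℝ, ∃ t : Fin 3 → ℝ,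
    M = Matrix.fromBlocks R 0 (hat t * R) R}

/-- A subgroup `H` of `GL(6, ℝ)` is an embedded Lie subgroup if, with the subspace topology and the
group law of `GL(6, ℝ)`, it admits a smooth manifold structure (modelled on some `ℝ^d`) for which
it is a Lie group and the inclusion `H → GL(6, ℝ)` is a smooth embedding. -/
def IsEmbeddedLieSubgroup (H : Subgroup GL6) : Prop :=
  ∃ (d : ℕ) (_ : ChartedSpace (EuclideanSpace ℝ (Fin d)) H),
    LieGroup (𝓡 d) ∞ H ∧
    Manifold.IsSmoothEmbedding (𝓡 d) 𝓘(ℝ, Mat6) ∞ (Subtype.val : H → GL6)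

/-! Write an element of the set as `[[a, 0], [c, a]]`, that is, as `a + εc` over the dual numbers
(`ε² = 0`). These block matrices form the centralizer of `nilBlock`, and `blockTranspose` acts on
them as transposition. The set is thus the orthogonal group `O(3)` over the dual numbers: the
equation `σ(A) A = 1` says that `a` is orthogonal and `c aᵀ` is skew, i.e. `c = [t]^∧ a`
(`mem_inducedAdjointSet_iff`). Closure under products and inverses, and topological closedness,
follow from these two equations.

For the smooth structure, the Cayley transform turns `σ(A) A = 1` into the linear equation `σ(Y) =
-Y` and preserves commutation with `nilBlock`. Near the identity it is therefore a chart of `GL(6,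
ℝ)` flattening the group onto a linear subspace; left translation gives such a slice chart around
every element. -/

/-! ### Slice charts and embedded submanifolds -/

open Set in
/-- A slice chart: if in the chart `ψ` of `N` the set `S` is cut out by the vanishing of the second
component of `E × F ≃L E'`, then the first component is a chart of `S`. -/
noncomputable def sliceChart {E E' F N : Type*} [NormedAddCommGroup E] [NormedSpace ℝ E]
    [NormedAddCommGroup E'] [NormedSpace ℝ E'] [NormedAddCommGroup F] [NormedSpace ℝ F]
    [TopologicalSpace N] {S : Set N} (L : (E × F) ≃L[ℝ] E') (ψ : OpenPartialHomeomorph N E')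
    (hψ : ∀ y ∈ ψ.source, y ∈ S ↔ (L.symm (ψ y)).2 = 0) (x : S) : OpenPartialHomeomorph S E :=
  open scoped Classical in
  have key : ∀ u : E, L (u, 0) ∈ ψ.target → ψ.symm (L (u, 0)) ∈ S := fun u hu =>
    (hψ _ (ψ.map_target hu)).2 (by simp [ψ.right_inv hu])
  { toFun := fun y => (L.symm (ψ y)).1
    -- Off the target the value is irrelevant; `x` is only a default point of `S`.
    invFun := fun u => if h : ψ.symm (L (u, 0)) ∈ S then ⟨_, h⟩ else x
    source := Subtype.val ⁻¹' ψ.source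
    target := {u | L (u, 0) ∈ ψ.target}
    map_source' := fun y hy => by
      have h2 := (hψ y hy).1 y.2
      have : L ((L.symm (ψ y)).1, 0) = ψ y := by rw [← h2]; simp
      simpa only [mem_ofPred_eq, this] using ψ.map_source hy
    map_target' := fun u hu => by
      simpa only [mem_preimage, dif_pos (key u hu)] using ψ.map_target hu
    left_inv' := fun y hy => by
      have h2 := (hψ y hy).1 y.2
      have : ψ.symm (L ((L.symm (ψ y)).1, 0)) = y := by
        rw [← h2]; simpa using ψ.left_inv hy
      have h3 : ψ.symm (L ((L.symm (ψ y)).1, 0)) ∈ S := by rw [this]; exact y.2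
      rw [dif_pos h3]
      exact Subtype.ext this
    right_inv' := fun u hu => by
      simp [dif_pos (key u hu), ψ.right_inv hu]
    open_source := ψ.open_source.preimage continuous_subtype_val
    open_target := ψ.open_target.preimage (by fun_prop)
    continuousOn_toFun := by
      have h : ContinuousOn (fun y : S => ψ y) (Subtype.val ⁻¹' ψ.source) :=
        ψ.continuousOn.comp continuous_subtype_val.continuousOn (fun _ h => h)
      exact (continuous_fst.comp L.symm.continuous).comp_continuousOn h
    continuousOn_invFun := by
      rw [Topology.IsInducing.subtypeVal.continuousOn_iff]
      have h : ContinuousOn (fun u : E => ψ.symm (L (u, 0))) {u | L (u, 0) ∈ ψ.target} :=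
        ψ.continuousOn_symm.comp (by fun_prop) (fun _ h => h)
      refine h.congr fun u hu => ?_
      simp [dif_pos (key u hu)] }

section Slice

open Set Manifold

variable {E E' F N : Type*} [NormedAddCommGroup E] [NormedSpace ℝ E]
  [NormedAddCommGroup E'] [NormedSpace ℝ E'] [NormedAddCommGroup F] [NormedSpace ℝ F]
  [TopologicalSpace N] {S : Set N} {L : (E × F) ≃L[ℝ] E'} {ψ : OpenPartialHomeomorph N E'}

@[simp]
lemma sliceChart_apply (hψ : ∀ y ∈ ψ.source, y ∈ S ↔ (L.symm (ψ y)).2 = 0) (x y : S) :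
    sliceChart L ψ hψ x y = (L.symm (ψ y)).1 := rfl

@[simp]
lemma sliceChart_source (hψ : ∀ y ∈ ψ.source, y ∈ S ↔ (L.symm (ψ y)).2 = 0) (x : S) :
    (sliceChart L ψ hψ x).source = Subtype.val ⁻¹' ψ.source := rfl

@[simp]
lemma sliceChart_target (hψ : ∀ y ∈ ψ.source, y ∈ S ↔ (L.symm (ψ y)).2 = 0) (x : S) :
    (sliceChart L ψ hψ x).target = {u | L (u, 0) ∈ ψ.target} := rfl

lemma sliceChart_symm_apply (hψ : ∀ y ∈ ψ.source, y ∈ S ↔ (L.symm (ψ y)).2 = 0) (x : S) {u : E}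
    (hu : L (u, 0) ∈ ψ.target) :
    ((sliceChart L ψ hψ x).symm u : N) = ψ.symm (L (u, 0)) := by
  have key : ψ.symm (L (u, 0)) ∈ S :=
    (hψ _ (ψ.map_target hu)).2 (by simp [ψ.right_inv hu])
  classical
  change ((if h : ψ.symm (L (u, 0)) ∈ S then ⟨_, h⟩ else x : S) : N) = _
  rw [dif_pos key]

/-- The slice criterion: a subset which in suitable charts of the maximal atlas is a linear
subspace is an embedded submanifold. -/
theorem exists_chartedSpace_isSmoothEmbedding_of_slices [ChartedSpace E' N]
    [IsManifold 𝓘(ℝ, E') ∞ N] (L : (E × F) ≃L[ℝ] E') (ψ : S → OpenPartialHomeomorph N E')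
    (hmem : ∀ x, ψ x ∈ IsManifold.maximalAtlas 𝓘(ℝ, E') ∞ N)
    (hx : ∀ x : S, (x : N) ∈ (ψ x).source)
    (hψ : ∀ x, ∀ y ∈ (ψ x).source, y ∈ S ↔ (L.symm (ψ x y)).2 = 0) :
    ∃ _ : ChartedSpace E S, IsManifold 𝓘(ℝ, E) ∞ S ∧
      IsSmoothEmbedding 𝓘(ℝ, E) 𝓘(ℝ, E') ∞ (Subtype.val : S → N) := by
  let cs : ChartedSpace E S :=
    { atlas := range fun x => sliceChart L (ψ x) (hψ x) x
      chartAt := fun x => sliceChart L (ψ x) (hψ x) x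
      mem_chart_source := hx
      chart_mem_atlas := fun x => mem_range_self x }
  have man : IsManifold 𝓘(ℝ, E) ∞ S := by
    apply isManifold_of_contDiffOn
    rintro _ _ ⟨x, rfl⟩ ⟨y, rfl⟩
    have h := (contDiffGroupoid ∞ 𝓘(ℝ, E')).compatible_of_mem_maximalAtlas (hmem x) (hmem y)
    rw [contDiffGroupoid, mem_groupoid_of_pregroupoid] at h
    have h1 : ContDiffOn ℝ ∞ ((ψ x).symm ≫ₕ ψ y) ((ψ x).symm ≫ₕ ψ y).source := by
      simpa [contDiffPregroupoid] using h.1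
    have h2 : ContDiffOn ℝ ∞ (fun u : E => (L.symm (((ψ x).symm ≫ₕ ψ y) (L (u, 0)))).1)
        {u | L (u, 0) ∈ ((ψ x).symm ≫ₕ ψ y).source} := by
      refine (contDiff_fst.comp L.symm.contDiff).comp_contDiffOn (h1.comp ?_ fun u hu => hu)
      exact (L.contDiff.comp (contDiff_id.prodMk contDiff_const)).contDiffOn
    refine (h2.mono ?_).congr ?_
    · rintro u ⟨hu, -⟩
      simp only [modelWithCornersSelf_coe_symm, preimage_id, OpenPartialHomeomorph.trans_source,
        OpenPartialHomeomorph.symm_source, mem_inter_iff, sliceChart_target,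
        sliceChart_source, mem_preimage, mem_ofPred_eq] at hu
      rw [sliceChart_symm_apply _ _ hu.1] at hu
      simpa using hu
    · rintro u ⟨hu, -⟩
      simp only [modelWithCornersSelf_coe_symm, preimage_id, OpenPartialHomeomorph.trans_source,
        OpenPartialHomeomorph.symm_source, mem_inter_iff, sliceChart_target,
        sliceChart_source, mem_preimage, mem_ofPred_eq] at hu
      simp [sliceChart_symm_apply _ _ hu.1]
  refine ⟨cs, man, ?_, Topology.IsEmbedding.subtypeVal⟩
  refine IsImmersionOfComplement.isImmersion (F := F) fun x => ?_
  refine IsImmersionAtOfComplement.mk_of_charts L (sliceChart L (ψ x) (hψ x) x) (ψ x) (hx x) (hx x)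
    (IsManifold.chart_mem_maximalAtlas x) (hmem x) (fun y hy => hy) ?_
  intro u hu
  have hu' : L (u, 0) ∈ (ψ x).target := by simpa using hu
  simp [sliceChart_symm_apply _ _ hu', (ψ x).right_inv hu']

/-- A subgroup of a Lie group which in suitable charts is a linear subspace is an embedded Lie
subgroup. -/
theorem Subgroup.exists_chartedSpace_lieGroup_of_slices {G : Type*} [Group G] [TopologicalSpace G]
    [ChartedSpace E' G] [LieGroup 𝓘(ℝ, E') ∞ G] (H : Subgroup G)
    (L : (E × F) ≃L[ℝ] E') (ψ : H → OpenPartialHomeomorph G E')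
    (hmem : ∀ x, ψ x ∈ IsManifold.maximalAtlas 𝓘(ℝ, E') ∞ G)
    (hx : ∀ x : H, (x : G) ∈ (ψ x).source)
    (hψ : ∀ x, ∀ y ∈ (ψ x).source, y ∈ H ↔ (L.symm (ψ x y)).2 = 0) :
    ∃ _ : ChartedSpace E H, LieGroup 𝓘(ℝ, E) ∞ H ∧
      IsSmoothEmbedding 𝓘(ℝ, E) 𝓘(ℝ, E') ∞ (Subtype.val : H → G) := by
  obtain ⟨cs, man, emb⟩ := exists_chartedSpace_isSmoothEmbedding_of_slices (S := (H : Set G)) L ψ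
    hmem hx hψ
  have : IsTopologicalGroup G := topologicalGroup_of_lieGroup 𝓘(ℝ, E') ∞
  let cs' : ChartedSpace E H := cs
  have man' : IsManifold 𝓘(ℝ, E) ∞ H := man
  have emb' : IsSmoothEmbedding 𝓘(ℝ, E) 𝓘(ℝ, E') ∞ (Subtype.val : H → G) := emb
  refine ⟨cs', { man' with contMDiff_mul := ?_, contMDiff_inv := ?_ }, emb'⟩
  -- A continuous map into `H` is smooth once its composite with the immersion into `G` is, so
  -- smoothness is inherited from `G`.
  · refine (ContMDiff.iff_comp_isImmersion emb'.isImmersion).2 ⟨continuous_mul, ?_⟩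
    exact (emb'.contMDiff.comp contMDiff_fst).mul (emb'.contMDiff.comp contMDiff_snd)
  · refine (ContMDiff.iff_comp_isImmersion emb'.isImmersion).2 ⟨continuous_inv, ?_⟩
    exact emb'.contMDiff.inv

end Slice

/-! ### The Cayley transform as a chart of a unit group -/

section Cayley

open Set Manifold

variable {R : Type*} [NormedRing R] [NormedAlgebra ℝ R]

/-- The Cayley transform `(1 - a) (1 + a)⁻¹`, written as `2 (1 + a)⁻¹ - 1`. -/
noncomputable def cayley (a : R) : R := (2 : ℝ) • Ring.inverse (1 + a) - 1

lemma one_add_cayley (a : R) : 1 + cayley a = (2 : ℝ) • Ring.inverse (1 + a) := by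
  simp [cayley]

lemma isUnit_one_add_cayley {a : R} (ha : IsUnit (1 + a)) : IsUnit (1 + cayley a) := by
  rw [one_add_cayley]
  exact ha.ringInverse.smul (Units.mk0 (2 : ℝ) two_ne_zero)

/-- Adding `1` turns the transform into `x ↦ 2 x⁻¹`, which is an involution. -/
lemma cayley_cayley {a : R} (ha : IsUnit (1 + a)) : cayley (cayley a) = a := by
  have h : Ring.inverse (1 + cayley a) = (1 / 2 : ℝ) • (1 + a) := by
    rw [one_add_cayley, ← mul_one (Ring.inverse ((2 : ℝ) • _)),
      Ring.inverse_mul_eq_iff_eq_mul _ _ _ (one_add_cayley a ▸ isUnit_one_add_cayley ha),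
      smul_mul_smul_comm, Ring.inverse_mul_cancel _ ha]
    norm_num
  rw [cayley, h, smul_smul]
  norm_num

/-- The Cayley transform commutes with whatever commutes with its argument. -/
lemma Commute.cayley_right {a b : R} (h : Commute b a) : Commute b (cayley a) := by
  have h' : Commute b (1 + a) := (Commute.one_right b).add_right h
  have hi : Commute b (Ring.inverse (1 + a)) := by
    by_cases hu : IsUnit (1 + a)
    · obtain ⟨u, hu⟩ := hu
      rw [← hu] at h' ⊢
      rw [Ring.inverse_unit]
      exact h'.units_inv_right
    · rw [Ring.inverse_non_unit _ hu]
      exact Commute.zero_right b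
  exact (hi.smul_right (2 : ℝ)).sub_right (Commute.one_right b)

/-- The Cayley transform exchanges the unitary and the skew elements of an anti-involution. -/
lemma map_cayley_eq_neg_iff (σ : R →ₗ[ℝ] R) (hσ : ∀ a b, σ (a * b) = σ b * σ a) (h1 : σ 1 = 1)
    {a : R} (ha : IsUnit (1 + a)) : σ (cayley a) = -cayley a ↔ σ a * a = 1 := by
  obtain ⟨u, hu⟩ := ha
  have hσu : σ (u⁻¹ : Rˣ) * σ u = 1 := by rw [← hσ, u.mul_inv, h1]
  have hσu' : σ u * σ (u⁻¹ : Rˣ) = 1 := by rw [← hσ, u.inv_mul, h1]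
  have ha : a = u - 1 := by rw [hu]; abel
  have hc : cayley a = (2 : ℝ) • ((u⁻¹ : Rˣ) : R) - 1 := by
    rw [cayley, ← hu, Ring.inverse_unit]
  have e1 : σ (cayley a) = -cayley a ↔ σ (u⁻¹ : Rˣ) + (u⁻¹ : Rˣ) = (1 : R) := by
    rw [hc, map_sub, map_smul, h1, eq_neg_iff_add_eq_zero, ← sub_eq_zero (b := (1 : R))]
    have : (2 : ℝ) • σ (u⁻¹ : Rˣ) - 1 + ((2 : ℝ) • ((u⁻¹ : Rˣ) : R) - 1)
        = (2 : ℝ) • (σ (u⁻¹ : Rˣ) + (u⁻¹ : Rˣ) - 1) := by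
      simp only [two_smul]; abel
    rw [this, smul_eq_zero_iff_right two_ne_zero]
  have e2 : σ (u⁻¹ : Rˣ) + (u⁻¹ : Rˣ) = (1 : R) ↔ u + σ u = σ u * u := by
    constructor
    -- Multiply by `σ u` on the left and by `u` on the right; the converse uses their inverses.
    · intro h
      have := congrArg (fun x => σ u * x * u) h
      simpa [mul_add, add_mul, hσu', mul_assoc] using this
    · intro h
      have := congrArg (fun x => σ (u⁻¹ : Rˣ) * x * (u⁻¹ : Rˣ)) h
      simpa [mul_add, add_mul, hσu, ← mul_assoc] using this
  rw [e1, e2, ha, map_sub, h1, sub_mul, mul_sub, mul_sub, ← sub_eq_zero,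
    ← sub_eq_zero (b := (1 : R)), ← neg_eq_zero]
  simp only [mul_one, one_mul]
  have : -((u : R) + σ u - σ u * u) = σ u * u - σ u - (u - 1) - 1 := by abel
  rw [this]

variable [CompleteSpace R]

lemma contDiffOn_cayley : ContDiffOn ℝ ∞ (cayley : R → R) {a | IsUnit (1 + a)} := by
  rintro a ⟨u, hu⟩
  have h : ContDiffAt ℝ ∞ Ring.inverse (1 + a) := hu ▸ contDiffAt_ringInverse ℝ u
  have h' : ContDiffAt ℝ ∞ (fun a : R => Ring.inverse (1 + a)) a :=
    h.comp a (contDiffAt_const.add contDiffAt_id)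
  exact ((h'.const_smul (2 : ℝ)).sub contDiffAt_const).contDiffWithinAt

variable (R) in
/-- The Cayley transform as an involutive chart. -/
noncomputable def cayleyChart : OpenPartialHomeomorph R R where
  toFun := cayley
  invFun := cayley
  source := {a | IsUnit (1 + a)}
  target := {a | IsUnit (1 + a)}
  map_source' _ ha := isUnit_one_add_cayley ha
  map_target' _ ha := isUnit_one_add_cayley ha
  left_inv' _ ha := cayley_cayley ha
  right_inv' _ ha := cayley_cayley ha
  open_source := Units.isOpen.preimage (continuous_const.add continuous_id)
  open_target := Units.isOpen.preimage (continuous_const.add continuous_id)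
  continuousOn_toFun := contDiffOn_cayley.continuousOn
  continuousOn_invFun := contDiffOn_cayley.continuousOn

/-- The translated Cayley chart `h ↦ cayley (g⁻¹ * h)` of the unit group around `g`. -/
noncomputable def unitsCayleyChart (g : Rˣ) : OpenPartialHomeomorph Rˣ R :=
  (Homeomorph.mulLeft g⁻¹).toOpenPartialHomeomorph ≫ₕ chartAt R (1 : Rˣ) ≫ₕ cayleyChart R

lemma unitsCayleyChart_apply (g h : Rˣ) :
    unitsCayleyChart g h = cayley ((g⁻¹ * h : Rˣ) : R) := rfl

lemma mem_unitsCayleyChart_source (g h : Rˣ) :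
    h ∈ (unitsCayleyChart g).source ↔ IsUnit (1 + ((g⁻¹ * h : Rˣ) : R)) := by
  have : h ∈ (unitsCayleyChart g).source ↔ True ∧ True ∧ IsUnit (1 + ((g⁻¹ * h : Rˣ) : R)) :=
    Iff.rfl
  simpa using this

lemma unitsCayleyChart_mem_maximalAtlas (g : Rˣ) :
    unitsCayleyChart g ∈ IsManifold.maximalAtlas 𝓘(ℝ, R) ∞ Rˣ := by
  apply OpenPartialHomeomorph.mem_maximalAtlas_of_contMDiffOn
  · have h : ContMDiff 𝓘(ℝ, R) 𝓘(ℝ, R) ∞ fun h : Rˣ => ((g⁻¹ * h : Rˣ) : R) :=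
      Units.contMDiff_val.comp (contMDiff_mul_left (a := g⁻¹))
    exact (contMDiffOn_iff_contDiffOn.2 contDiffOn_cayley).comp h.contMDiffOn
      fun h hh => (mem_unitsCayleyChart_source g h).1 hh
  · have h : ContMDiffOn 𝓘(ℝ, R) 𝓘(ℝ, R) ∞ (chartAt R (1 : Rˣ)).symm (chartAt R (1 : Rˣ)).target :=
      contMDiffOn_chart_symm
    have h2 : ContMDiffOn 𝓘(ℝ, R) 𝓘(ℝ, R) ∞ (cayley : R → R) (unitsCayleyChart g).target :=
      (contMDiffOn_iff_contDiffOn.2 contDiffOn_cayley).mono fun a ha => ha.1.1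
    -- The inverse chart is the Cayley transform again, followed by translation by `g`.
    refine (contMDiff_mul_left (a := g)).comp_contMDiffOn (h.comp h2 fun a ha => ha.1.2) |>.congr ?_
    intro a _
    simp [unitsCayleyChart, cayleyChart, Homeomorph.mulLeft_symm]

/-- A subgroup of the unit group that the Cayley transform linearizes is an embedded Lie
subgroup. -/
theorem Subgroup.exists_chartedSpace_lieGroup_of_cayley [FiniteDimensional ℝ R]
    (H : Subgroup Rˣ) (V : Submodule ℝ R)
    (hH : ∀ q : Rˣ, IsUnit (1 + (q : R)) → (q ∈ H ↔ cayley (q : R) ∈ V)) :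
    ∃ (d : ℕ) (_ : ChartedSpace (EuclideanSpace ℝ (Fin d)) H), LieGroup (𝓡 d) ∞ H ∧
      IsSmoothEmbedding (𝓡 d) 𝓘(ℝ, R) ∞ (Subtype.val : H → Rˣ) := by
  obtain ⟨W, hW⟩ := V.exists_isCompl
  let e : V ≃L[ℝ] EuclideanSpace ℝ (Fin (Module.finrank ℝ V)) :=
    ContinuousLinearEquiv.ofFinrankEq (by simp)
  let L₀ : (V × W) ≃L[ℝ] R := (Submodule.prodEquivOfIsCompl V W hW).toContinuousLinearEquiv
  let L := (e.symm.prodCongr (ContinuousLinearEquiv.refl ℝ W)).trans L₀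
  refine ⟨Module.finrank ℝ V, H.exists_chartedSpace_lieGroup_of_slices L
    (fun g => unitsCayleyChart g) (fun g => unitsCayleyChart_mem_maximalAtlas _) (fun g => ?_) ?_⟩
  -- At the centre `y = g` the condition is that `1 + 1 = 2` be invertible.
  · rw [mem_unitsCayleyChart_source, inv_mul_cancel, Units.val_one]
    rw [← two_smul ℝ (1 : R)]
    exact isUnit_one.smul (Units.mk0 (2 : ℝ) two_ne_zero)
  · intro g y hy
    rw [mem_unitsCayleyChart_source] at hy
    -- Translation by `g⁻¹ ∈ H` preserves `H`, which reduces the slice condition to `hH`.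
    have h1 : y ∈ H ↔ (g : Rˣ)⁻¹ * y ∈ H := (H.mul_mem_cancel_left (H.inv_mem g.2)).symm
    rw [h1, hH _ hy, unitsCayleyChart_apply]
    exact (Submodule.prodEquivOfIsCompl_symm_apply_snd_eq_zero _ _ hW).symm

end Cayley

/-! ### The group as unitary elements of a centralizer -/

section InducedAdjoint

open Matrix

/-- The matrices `hat t` are exactly the skew-symmetric ones. -/
lemma exists_hat_eq_iff (X : Matrix (Fin 3) (Fin 3) ℝ) : (∃ t, X = hat t) ↔ Xᵀ = -X := by
  constructor
  · rintro ⟨t, rfl⟩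
    ext i j
    fin_cases i <;> fin_cases j <;> simp [hat]
  · intro h
    have h' : ∀ i j, X j i = -X i j := fun i j => congrFun (congrFun h i) j
    have h0 : ∀ i, X i i = 0 := fun i => by linarith [h' i i]
    refine ⟨![X 2 1, X 0 2, X 1 0], ?_⟩
    ext i j
    fin_cases i <;> fin_cases j <;> simp [hat, h0, ← h']

/-- The nilpotent matrix whose centralizer consists of the blocks `[[a, 0], [c, a]]`. -/
def nilBlock : Mat6 := fromBlocks 0 0 1 0

/-- The anti-involution of `6 × 6` matrices that transposes and exchanges the two diagonal
blocks. -/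
def blockTranspose : Mat6 →ₗ[ℝ] Mat6 where
  toFun A := fromBlocks 0 1 1 0 * Aᵀ * fromBlocks 0 1 1 0
  map_add' A B := by simp [mul_add, add_mul]
  map_smul' c A := by simp

lemma blockTranspose_mul (A B : Mat6) :
    blockTranspose (A * B) = blockTranspose B * blockTranspose A := by
  have h : (fromBlocks 0 1 1 0 : Mat6) * fromBlocks 0 1 1 0 = 1 := by
    simp [fromBlocks_multiply]
  simp only [blockTranspose, LinearMap.coe_mk, AddHom.coe_mk, transpose_mul]
  calc _ = fromBlocks 0 1 1 0 * Bᵀ * 1 * Aᵀ * fromBlocks 0 1 1 0 := by simp only [mul_assoc, one_mul]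
    _ = _ := by rw [← h]; simp only [mul_assoc]

lemma blockTranspose_one : blockTranspose 1 = 1 := by
  simp [blockTranspose, fromBlocks_multiply]

lemma blockTranspose_fromBlocks (a b c d : Matrix (Fin 3) (Fin 3) ℝ) :
    blockTranspose (fromBlocks a b c d) = fromBlocks dᵀ bᵀ cᵀ aᵀ := by
  simp [blockTranspose, fromBlocks_multiply, fromBlocks_transpose]

lemma commute_nilBlock_iff (a b c d : Matrix (Fin 3) (Fin 3) ℝ) :
    Commute nilBlock (fromBlocks a b c d) ↔ b = 0 ∧ a = d := by
  simp [Commute, SemiconjBy, nilBlock, fromBlocks_multiply, fromBlocks_inj, eq_comm]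
  tauto

/-- The set consists of the unitary elements, for the block transpose, of the centralizer of
`nilBlock`. -/
lemma mem_inducedAdjointSet_iff (A : Mat6) :
    A ∈ inducedAdjointSet ↔ Commute nilBlock A ∧ blockTranspose A * A = 1 := by
  obtain ⟨a, b, c, d, rfl⟩ : ∃ a b c d, A = fromBlocks a b c d :=
    ⟨_, _, _, _, (fromBlocks_toBlocks A).symm⟩
  rw [commute_nilBlock_iff, blockTranspose_fromBlocks, fromBlocks_multiply, ← fromBlocks_one,
    fromBlocks_inj]
  constructor
  · rintro ⟨R, hR, t, h⟩
    obtain ⟨rfl, rfl, rfl, rfl⟩ := fromBlocks_inj.1 h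
    have hR' : dᵀ * d = 1 := (mem_orthogonalGroup_iff' _ _).1 hR
    have ht : (hat t)ᵀ = -hat t := (exists_hat_eq_iff _).1 ⟨t, rfl⟩
    simp [hR', ht, transpose_mul, mul_assoc]
  · rintro ⟨⟨rfl, rfl⟩, h1, -, h3, -⟩
    have h1' : aᵀ * a = 1 := by simpa using h1
    have h2' : a * aᵀ = 1 := mul_eq_one_comm.1 h1'
    have hs : (c * aᵀ)ᵀ = -(c * aᵀ) := by
      rw [eq_neg_iff_add_eq_zero, transpose_mul, transpose_transpose]
      -- The lower left block of the unitarity equation is `cᵀ a + aᵀ c = 0`; conjugating it by the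
      -- orthogonal `a` gives skewness of `c aᵀ`.
      calc a * cᵀ + c * aᵀ = a * (cᵀ * a + aᵀ * c) * aᵀ := by
            simp only [mul_add, add_mul, mul_assoc, h2', mul_one]
            rw [← mul_assoc a aᵀ, h2', one_mul]
        _ = 0 := by rw [h3]; simp
    obtain ⟨t, ht⟩ := (exists_hat_eq_iff _).2 hs
    refine ⟨a, (mem_orthogonalGroup_iff' _ _).2 h1', t, ?_⟩
    rw [← ht, mul_assoc, h1', mul_one]

lemma mul_mem_inducedAdjointSet {A B : Mat6} (hA : A ∈ inducedAdjointSet)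
    (hB : B ∈ inducedAdjointSet) : A * B ∈ inducedAdjointSet := by
  rw [mem_inducedAdjointSet_iff] at *
  refine ⟨hA.1.mul_right hB.1, ?_⟩
  rw [blockTranspose_mul, mul_assoc, ← mul_assoc _ A, hA.2, one_mul, hB.2]

lemma isUnit_of_mem_inducedAdjointSet {A : Mat6} (hA : A ∈ inducedAdjointSet) : IsUnit A :=
  IsUnit.of_mul_eq_one_right _ ((mem_inducedAdjointSet_iff A).1 hA).2

lemma val_inv_mem_inducedAdjointSet {g : GL6} (hg : (g : Mat6) ∈ inducedAdjointSet) :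
    ((g⁻¹ : GL6) : Mat6) ∈ inducedAdjointSet := by
  rw [mem_inducedAdjointSet_iff] at *
  refine ⟨hg.1.units_inv_right, ?_⟩
  have h : blockTranspose (g : Mat6) = (g⁻¹ : GL6) := Units.eq_inv_of_mul_eq_one_right hg.2
  rw [← h, ← blockTranspose_mul, h, Units.mul_inv, blockTranspose_one]

/-- The group `inducedAdjointSet` as a subgroup of `GL(6, ℝ)`. -/
def inducedAdjointSubgroup : Subgroup GL6 where
  carrier := {g | (g : Mat6) ∈ inducedAdjointSet}
  mul_mem' := fun ha hb => mul_mem_inducedAdjointSet ha hb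
  one_mem' := (mem_inducedAdjointSet_iff 1).2 ⟨Commute.one_right _, by simp [blockTranspose_one]⟩
  inv_mem' := fun h => val_inv_mem_inducedAdjointSet h

lemma isClosed_inducedAdjointSet : IsClosed inducedAdjointSet := by
  have h : inducedAdjointSet =
      {A | nilBlock * A = A * nilBlock} ∩ {A | blockTranspose A * A = 1} :=
    Set.ext mem_inducedAdjointSet_iff
  have hc : Continuous blockTranspose := LinearMap.continuous_of_finiteDimensional _
  rw [h]
  exact (isClosed_eq (by fun_prop) (by fun_prop)).inter (isClosed_eq (by fun_prop) (by fun_prop))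

/-- The Lie algebra: the skew elements of the centralizer of `nilBlock`. -/
def inducedAdjointLieAlgebra : Submodule ℝ Mat6 where
  carrier := {Y | Commute nilBlock Y ∧ blockTranspose Y = -Y}
  add_mem' := fun ha hb => ⟨ha.1.add_right hb.1, by rw [map_add, ha.2, hb.2, neg_add]⟩
  zero_mem' := ⟨Commute.zero_right _, by simp⟩
  smul_mem' := fun c _ h => ⟨h.1.smul_right c, by rw [map_smul, h.2, smul_neg]⟩

lemma mem_inducedAdjointSubgroup_iff_cayley (q : GL6) (hq : IsUnit (1 + (q : Mat6))) :
    q ∈ inducedAdjointSubgroup ↔ cayley (q : Mat6) ∈ inducedAdjointLieAlgebra := by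
  change (q : Mat6) ∈ inducedAdjointSet ↔ Commute nilBlock (cayley (q : Mat6)) ∧ _
  rw [mem_inducedAdjointSet_iff,
    map_cayley_eq_neg_iff blockTranspose blockTranspose_mul blockTranspose_one hq]
  refine and_congr_left fun _ => ⟨fun h => h.cayley_right, fun h => ?_⟩
  -- The transform is an involution, so commutation passes back from `cayley q` to `q`.
  simpa [cayley_cayley hq] using h.cayley_right

theorem isEmbeddedLieSubgroup_inducedAdjointSubgroup :
    IsEmbeddedLieSubgroup inducedAdjointSubgroup :=
  Subgroup.exists_chartedSpace_lieGroup_of_cayley (R := Mat6) inducedAdjointSubgroup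
    inducedAdjointLieAlgebra mem_inducedAdjointSubgroup_iff_cayley

end InducedAdjoint

/-! ### The main theorem -/

theorem theorem2 :
    (∀ A ∈ inducedAdjointSet, ∀ B ∈ inducedAdjointSet, A * B ∈ inducedAdjointSet) ∧
    (∀ A ∈ inducedAdjointSet, IsUnit A ∧ A⁻¹ ∈ inducedAdjointSet) ∧
    IsClosed {g : GL6 | (g : Mat6) ∈ inducedAdjointSet} ∧
    ∃ H : Subgroup GL6,
      (fun g : GL6 => (g : Mat6)) '' (H : Set GL6) = inducedAdjointSet ∧
      IsEmbeddedLieSubgroup H := by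
  refine ⟨fun A hA B hB => mul_mem_inducedAdjointSet hA hB, fun A hA => ?_,
    isClosed_inducedAdjointSet.preimage Units.continuous_val, inducedAdjointSubgroup, ?_,
    isEmbeddedLieSubgroup_inducedAdjointSubgroup⟩
  · have hu := isUnit_of_mem_inducedAdjointSet hA
    refine ⟨hu, ?_⟩
    obtain ⟨g, rfl⟩ := hu
    rw [← Matrix.coe_units_inv]
    exact val_inv_mem_inducedAdjointSet hA
  · refine Set.Subset.antisymm ?_ fun A hA => ?_
    · rintro _ ⟨g, hg, rfl⟩
      exact hg
    · obtain ⟨g, rfl⟩ := isUnit_of_mem_inducedAdjointSet hA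
      exact ⟨g, hA, rfl⟩
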